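/- Let $X$ be a finite metric space with a distinguished root $r \in X$. For a set of requests $S \subseteq X$ let $c_{X,r}(S)$ be the optimal (subset) TSP cost, that is, the minimum length of a closed tour in $X$ that visits $r$ and every point of $S$. A function $g : 2^X \to \mathbb{R}$ is submodular if $g(A) + g(B) \ge g(A \cup B) + g(A \cap B)$ for all $A, B \subseteq X$, and the submodularity gap $SG(f)$ of a function $f : 2^X \to \mathbb{R}$ is the least $\lambda \ge 0$ for which there is a submodular $g$ with $f(S) \le g(S) \le \lambda f(S)$ for all $S \subseteq X$ (with $SG(f) = \infty$ if there is no such $\lambda$). Let $SG(TSP)(n)$ be the supremum of $SG(c_{X,r})$ over all $n$-point metric spaces $X$ and all roots $r \in X$. Then $SG(TSP)(n) = \Theta(\log n)$: there are absolute constants $c, C > 0$ such that, for every $n \ge 2$, $$c \log n \le SG(TSP)(n) \le C \log n .$$ -/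

import Mathlib

open scoped NNReal ENNReal

universe u

/-- A real set function `g` on the subsets of `X` is submodular. -/
def SubmodularFn {X : Type*} (g : Set X → ℝ) : Prop :=
  ∀ A B : Set X, g (A ∪ B) + g (A ∩ B) ≤ g A + g B

/-- `f` is `lam`-approximated by a submodular function `g`: `f S ≤ g S ≤ lam * f S` for all `S`. -/
def SubmodularApprox {X : Type*} (f : Set X → ℝ) (lam : ℝ) : Prop :=
  ∃ g : Set X → ℝ, SubmodularFn g ∧ ∀ S : Set X, f S ≤ g S ∧ g S ≤ lam * f S

/-- The submodularity gap of `f`: the least `lam` for which `f` is `lam`-approximated by a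
submodular function (and `∞` if there is none). -/
noncomputable def submodularityGap {X : Type*} (f : Set X → ℝ) : ℝ≥0∞ :=
  ⨅ (lam : ℝ≥0) (_ : SubmodularApprox f lam), (lam : ℝ≥0∞)

/-- The length of the walk that visits the points of a list in order. -/
noncomputable def walkLength {X : Type*} [MetricSpace X] : List X → ℝ
  | [] => 0
  | [_] => 0
  | x :: y :: l => dist x y + walkLength (y :: l)

/-- The optimal cost of (subset) TSP with root `r` and request set `S`: the least length of a
closed walk `r → l → r` which visits every point of `S`. -/
noncomputable def tspCost {X : Type*} [MetricSpace X] (r : X) (S : Set X) : ℝ :=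
  sInf {L : ℝ | ∃ l : List X, (∀ s ∈ S, s ∈ r :: l) ∧ L = walkLength (r :: (l ++ [r]))}

/-- The submodularity gap of (subset) TSP on `n` points: the supremum, over all `n`-point metric
spaces `X` and all roots `r` in `X`, of the submodularity gap of `S ↦ tspCost r S`. -/
noncomputable def tspSubmodularityGap (n : ℕ) : ℝ≥0∞ :=
  ⨆ (X : Type u) (_ : MetricSpace X) (_ : Fintype X) (_ : Fintype.card X = n) (r : X),
    submodularityGap (fun S : Set X => tspCost r S)

open MeasureTheory

/-! Upper bound. Fix an order `π` of the points and, at each scale `ρ`, send every point to the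
first point of its closed `ρ`-ball. The number of clusters meeting `S`, apart from the root's
cluster, is a coverage function of `S`, hence submodular, and so is its integral over `ρ`. Joining
cluster centres from coarse scales to fine ones builds a tour of cost at most 20 times this
integral, for every `π` (`tspCost_le_clusterIntegral`). Conversely, for a uniformly random `π`, the
expected measure of the scales separating `u` from `v` is at most `harmonic n * dist u v`
(`sum_integral_ballCenter_ne_le`). Summing over the edges of a tour bounds the average integral by
`harmonic n` times the tour length (`sum_clusterIntegral_le`). The average over `π` of 20 times the
integral is therefore a submodular approximation with factor O(log n).

Lower bound. In the sup metric, take `2 ^ k` sawtooth paths from the origin, each with tour cost at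
most 2. At times that are odd multiples of `2⁻⁽ʲ⁺¹⁾` only the lowest `j + 1` bits of the index
matter, so each vertex there lies on at least `2 ^ (k - 1 - j)` paths, while distinct vertices are
`2⁻⁽ʲ⁺¹⁾` apart. A level set of multiplicity up to `2 ^ (k - 1 - j)` thus contains `2 ^ (2 * j + 1)`
separated points and costs at least `2 ^ j`. Summed over multiplicities, the level sets cost at
least of order `k * 2 ^ k`, whereas uncrossing (`SubmodularFn.sum_levelSets_le`) bounds the sum of
`g` over them by the sum over the paths, at most `2 * lam * 2 ^ k`. Hence `lam` is at least of order
`k`, on at most `2 * 4 ^ k` points. -/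

/-! ### Walks and tour costs -/

theorem walkLength_nonneg {X : Type*} [MetricSpace X] : ∀ l : List X, 0 ≤ walkLength l
  | [] => le_rfl
  | [_] => le_rfl
  | _ :: y :: l => add_nonneg dist_nonneg (walkLength_nonneg (y :: l))

theorem walkLength_cons_le_of_erase {X : Type*} [MetricSpace X] (x y : X) (l : List X) :
    walkLength (x :: l) ≤ walkLength (x :: y :: l) := by
  cases l with
  | nil => exact walkLength_nonneg _
  | cons z l =>
    simp only [walkLength]
    linarith [dist_triangle x y z]

theorem walkLength_append_detour {X : Type*} [MetricSpace X] (a z : X) (l₂ : List X) :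
    ∀ l₁ : List X,
      walkLength (l₁ ++ z :: a :: z :: l₂) = walkLength (l₁ ++ z :: l₂) + 2 * dist a z
  | [] => by simp only [List.nil_append, walkLength, dist_comm z a]; ring
  | [x] => by
      simp only [List.cons_append, List.nil_append, walkLength, dist_comm z a]; ring
  | x :: y :: l => by
      have := walkLength_append_detour a z l₂ (y :: l)
      simp only [List.cons_append, walkLength] at this ⊢
      linarith

theorem tspCost_le {X : Type*} [MetricSpace X] {r : X} {S : Set X} {l : List X}
    (h : ∀ s ∈ S, s ∈ r :: l) : tspCost r S ≤ walkLength (r :: (l ++ [r])) :=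
  csInf_le ⟨0, by rintro _ ⟨l, -, rfl⟩; exact walkLength_nonneg _⟩ ⟨l, h, rfl⟩

theorem le_tspCost {X : Type*} [MetricSpace X] [Finite X] {r : X} {S : Set X} {b : ℝ}
    (h : ∀ l : List X, (∀ s ∈ S, s ∈ r :: l) → b ≤ walkLength (r :: (l ++ [r]))) :
    b ≤ tspCost r S := by
  have := Fintype.ofFinite X
  refine le_csInf ⟨_, Finset.univ.toList, by simp, rfl⟩ ?_
  rintro _ ⟨l, hl, rfl⟩
  exact h l hl

theorem tspCost_nonneg {X : Type*} [MetricSpace X] (r : X) (S : Set X) : 0 ≤ tspCost r S :=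
  Real.sInf_nonneg (by rintro _ ⟨l, -, rfl⟩; exact walkLength_nonneg _)

theorem tspCost_mono {X : Type*} [MetricSpace X] [Finite X] (r : X) {S T : Set X} (h : S ⊆ T) :
    tspCost r S ≤ tspCost r T :=
  le_tspCost fun _ hl => tspCost_le fun s hs => hl s (h hs)

theorem tspCost_le_of_subset_root {X : Type*} [MetricSpace X] {r : X} {S : Set X}
    (h : S ⊆ {r}) : tspCost r S ≤ 0 := by
  have := tspCost_le (r := r) (S := S) (l := []) (fun s hs => by simpa using h hs)
  simpa [walkLength] using this

theorem tspCost_insert_root_le {X : Type*} [MetricSpace X] [Finite X] (r : X) (S : Set X) :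
    tspCost r (insert r S) ≤ tspCost r S :=
  le_tspCost fun _ hl => tspCost_le fun s hs => hs.elim (fun h => by simp [h]) (hl s)

/-- Any tour for `S` visits `z`; at one such visit, splice in the detour `z → a → z`. -/
theorem tspCost_insert_le {X : Type*} [MetricSpace X] [Finite X] {r a z : X} {S : Set X}
    (hz : z ∈ insert r S) : tspCost r (insert a S) ≤ tspCost r S + 2 * dist a z := by
  rw [← sub_le_iff_le_add]
  refine le_tspCost fun l hl => ?_
  have hzl : z ∈ r :: l := hz.elim (fun h => by simp [h]) (hl z)
  obtain ⟨l₁, l₂, h⟩ := List.append_of_mem hzl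
  have key : ∃ l' : List X, r :: l' = l₁ ++ z :: a :: z :: l₂ := by
    cases l₁ with
    | nil => exact ⟨a :: z :: l₂, by simp at h; simp [h.1]⟩
    | cons x l₁ => exact ⟨l₁ ++ z :: a :: z :: l₂, by simp at h; simp [h.1]⟩
  obtain ⟨l', hl'⟩ := key
  have h1 : tspCost r (insert a S) ≤ walkLength (r :: (l' ++ [r])) := by
    refine tspCost_le fun s hs => ?_
    rw [hl']
    rcases hs with rfl | hs
    · simp
    · have := hl s hs
      rw [h] at this
      simp only [List.mem_append, List.mem_cons] at this ⊢
      tauto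
  rw [← List.cons_append, hl', List.append_assoc] at h1
  rw [← List.cons_append, h, List.append_assoc]
  have h2 := walkLength_append_detour a z (l₂ ++ [r]) l₁
  simp only [List.cons_append] at h1 ⊢
  linarith

theorem tspCost_le_add_of_near {X : Type*} [MetricSpace X] [Finite X] {r : X} {A B : Set X}
    {K : ℝ} (h : ∀ a ∈ A, ∃ b ∈ insert r B, dist a b ≤ K) :
    tspCost r A ≤ tspCost r B + 2 * K * A.ncard := by
  have key : tspCost r (A ∪ B) ≤ tspCost r B + 2 * K * A.ncard := by
    induction A, A.toFinite using Set.Finite.induction_on with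
    | empty => simp
    | @insert a A ha _ ih =>
      have ih := ih fun x hx => h x (Set.mem_insert_of_mem _ hx)
      obtain ⟨b, hb, hab⟩ := h a (Set.mem_insert _ _)
      have h1 := tspCost_insert_le (a := a) (S := A ∪ B) (r := r) (z := b)
        (Set.insert_subset_insert Set.subset_union_right hb)
      rw [Set.insert_union, Set.ncard_insert_of_notMem ha]
      push_cast
      linarith
  exact (tspCost_mono r Set.subset_union_left).trans key

/-- Shortcut the walk past the points outside `E`: each remaining first arrival at a point of `E`
costs at least `δ`. Intermediate points may be arbitrary, so extra points of the space cannot help a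
tour. -/
theorem card_mul_le_walkLength {X : Type*} [MetricSpace X] [DecidableEq X] {δ : ℝ} (l : List X) :
    ∀ (x : X) (E : Finset X), x ∉ E → (∀ y ∈ E, y ∈ l) →
      (∀ y ∈ insert x E, ∀ z ∈ insert x E, y ≠ z → δ ≤ dist y z) →
      E.card * δ ≤ walkLength (x :: l) := by
  induction l with
  | nil =>
    intro x E _ hE _
    have : E = ∅ := Finset.eq_empty_of_forall_notMem fun y hy => by simpa using hE y hy
    simp [this, walkLength]
  | cons y l ih =>
    intro x E hx hE hsep
    by_cases hy : y ∈ E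
    · have h1 := ih y (E.erase y) (Finset.notMem_erase _ _)
        (fun z hz => by
          have := hE z (Finset.mem_of_mem_erase hz)
          simpa [Finset.ne_of_mem_erase hz] using this)
        (by
          rw [Finset.insert_erase hy]
          exact fun u hu v hv => hsep u (Finset.mem_insert_of_mem hu) v (Finset.mem_insert_of_mem hv))
      have h2 := hsep x (Finset.mem_insert_self _ _) y (Finset.mem_insert_of_mem hy)
        (fun h => hx (h ▸ hy))
      have h3 : (E.card : ℝ) = (E.erase y).card + 1 := by
        exact_mod_cast (Finset.card_erase_add_one hy).symm
      simp only [walkLength]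
      rw [h3]
      linarith
    · refine (ih x E hx (fun z hz => ?_) hsep).trans (walkLength_cons_le_of_erase x y l)
      have := hE z hz
      simpa [show z ≠ y from fun h => hy (h ▸ hz)] using this

theorem card_mul_le_tspCost {X : Type*} [MetricSpace X] [Finite X] [DecidableEq X] {δ : ℝ} {r : X}
    {S : Set X} (E : Finset X) (hr : r ∉ E) (hES : ∀ y ∈ E, y ∈ S)
    (hsep : ∀ y ∈ insert r E, ∀ z ∈ insert r E, y ≠ z → δ ≤ dist y z) :
    E.card * δ ≤ tspCost r S :=
  le_tspCost fun l hl => card_mul_le_walkLength (l ++ [r]) r E hr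
    (fun y hy => by have := hl y (hES y hy); simp at this ⊢; tauto) hsep

/-! ### Uncrossing -/

/-- Uncrossing a finite family of sets into its level sets does not increase the total value of a
submodular function. -/
theorem SubmodularFn.sum_levelSets_le {X ι : Type*} [DecidableEq ι] {g : Set X → ℝ}
    (hg : SubmodularFn g) (P : ι → Set X) (s : Finset ι) :
    ∑ m ∈ Finset.range s.card, g {x | m + 1 ≤ {i ∈ (s : Set ι) | x ∈ P i}.ncard} ≤
      ∑ i ∈ s, g (P i) := by
  induction s using Finset.induction_on with
  | empty => simp
  | @insert a s ha ih =>
    set L : ℕ → Set X := fun m => {x | m ≤ {i ∈ (s : Set ι) | x ∈ P i}.ncard} with hL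
    have hfin : ∀ x, {i ∈ (s : Set ι) | x ∈ P i}.Finite := fun x =>
      s.finite_toSet.subset fun i hi => hi.1
    have hL' : ∀ m, {x | m + 1 ≤ {i ∈ ((insert a s : Finset ι) : Set ι) | x ∈ P i}.ncard} =
        L (m + 1) ∪ (L m ∩ P a) := by
      intro m
      ext x
      by_cases hx : x ∈ P a
      · have : {i ∈ ((insert a s : Finset ι) : Set ι) | x ∈ P i} =
            insert a {i ∈ (s : Set ι) | x ∈ P i} := by
          ext i; simp only [Finset.coe_insert, Set.mem_insert_iff, Set.mem_ofPred_eq]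
          constructor
          · tauto
          · rintro (rfl | h) <;> tauto
        simp only [Set.mem_ofPred_eq, this, hL, Set.mem_union, Set.mem_inter_iff, hx, and_true]
        rw [Set.ncard_insert_of_notMem (fun h => ha h.1) (hfin x)]
        omega
      · have : {i ∈ ((insert a s : Finset ι) : Set ι) | x ∈ P i} =
            {i ∈ (s : Set ι) | x ∈ P i} := by
          ext i; simp only [Finset.coe_insert, Set.mem_insert_iff, Set.mem_ofPred_eq]
          constructor
          · rintro ⟨rfl | h, h'⟩ <;> tauto
          · tauto
        simp only [Set.mem_ofPred_eq, this, hL, Set.mem_union, Set.mem_inter_iff, hx, and_false,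
          or_false]
    -- Push the new set `P a` down through the nested levels: uncrossing `L q ∩ P a` with `L (q +
    -- 1)` leaves the remainder `L (q + 1) ∩ P a` for the next level. It starts as `P a`, since `L
    -- 0` is everything.
    have step : ∀ q, ∑ m ∈ Finset.range q, g (L (m + 1) ∪ (L m ∩ P a)) + g (L q ∩ P a) ≤
        ∑ m ∈ Finset.range q, g (L (m + 1)) + g (P a) := by
      intro q
      induction q with
      | zero => simp [hL]
      | succ q ihq =>
        rw [Finset.sum_range_succ, Finset.sum_range_succ]
        have h1 := hg (L (q + 1)) (L q ∩ P a)
        have h2 : L (q + 1) ∩ (L q ∩ P a) = L (q + 1) ∩ P a := by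
          ext x; simp only [hL, Set.mem_inter_iff, Set.mem_ofPred_eq]
          constructor
          · tauto
          · rintro ⟨h, h'⟩; exact ⟨h, by omega, h'⟩
        rw [h2] at h1
        linarith
    rw [Finset.card_insert_of_notMem ha, Finset.sum_insert ha]
    simp only [hL']
    rw [Finset.sum_range_succ]
    have h3 : L (s.card + 1) = ∅ := by
      refine Set.eq_empty_of_forall_notMem fun x hx => ?_
      have : {i ∈ (s : Set ι) | x ∈ P i}.ncard ≤ s.card := by
        rw [← Set.ncard_coe_finset]
        exact Set.ncard_le_ncard (fun i hi => hi.1) s.finite_toSet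
      simp only [hL, Set.mem_ofPred_eq] at hx
      omega
    rw [h3, Set.empty_union]
    have := step s.card
    linarith

/-! ### Random orders and ranks -/

/-- Swapping `w` with `u` shows that every `u ∈ W` comes first in `W` at least as often as `w`, and
these events are disjoint for distinct `u`. -/
theorem card_equiv_isMin {X : Type*} [Fintype X] [DecidableEq X] {n : ℕ} (W : Finset X) {w : X}
    (hw : w ∈ W) :
    W.card * (Finset.univ.filter fun π : X ≃ Fin n => ∀ v ∈ W, π w ≤ π v).card ≤
      Fintype.card (X ≃ Fin n) := by
  have hsymm : ∀ u ∈ W, (Finset.univ.filter fun π : X ≃ Fin n => ∀ v ∈ W, π w ≤ π v).card ≤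
      (Finset.univ.filter fun π : X ≃ Fin n => ∀ v ∈ W, π u ≤ π v).card := by
    intro u hu
    refine Finset.card_le_card_of_injOn (fun π => (Equiv.swap w u).trans π) ?_ ?_
    · intro π hπ
      simp only [Finset.coe_filter, Finset.mem_univ, true_and, Set.mem_ofPred_eq,
        Equiv.trans_apply, Equiv.swap_apply_right] at hπ ⊢
      intro v hv
      apply hπ
      by_cases h1 : v = w
      · simpa [h1] using hu
      by_cases h2 : v = u
      · simpa [h2] using hw
      · rwa [Equiv.swap_apply_of_ne_of_ne h1 h2]
    · intro π _ π' _ h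
      ext x
      have := congrArg (fun e : X ≃ Fin n => e (Equiv.swap w u x)) h
      simpa using congrArg Fin.val this
  calc W.card * (Finset.univ.filter fun π : X ≃ Fin n => ∀ v ∈ W, π w ≤ π v).card
      = ∑ _u ∈ W, (Finset.univ.filter fun π : X ≃ Fin n => ∀ v ∈ W, π w ≤ π v).card := by simp
    _ ≤ ∑ u ∈ W, (Finset.univ.filter fun π : X ≃ Fin n => ∀ v ∈ W, π u ≤ π v).card :=
        Finset.sum_le_sum hsymm
    _ = (W.biUnion fun u => Finset.univ.filter fun π : X ≃ Fin n => ∀ v ∈ W, π u ≤ π v).card := by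
        rw [Finset.card_biUnion]
        intro u hu v hv huv
        refine Finset.disjoint_left.mpr fun π h1 h2 => huv ?_
        simp only [Finset.mem_filter, Finset.mem_univ, true_and] at h1 h2
        exact π.injective (le_antisymm (h1 v hv) (h2 u hu))
    _ ≤ Fintype.card (X ≃ Fin n) := Finset.card_le_univ _

/-- Without ties the ranks are 1, 2, …; a tie only raises ranks and so lowers the sum. -/
theorem sum_inv_rank_le_harmonic {X : Type*} [DecidableEq X] (f : X → ℝ) (s : Finset X) :
    ∑ w ∈ s, ((s.filter fun v => f v ≤ f w).card : ℝ)⁻¹ ≤ (harmonic s.card : ℚ) := by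
  induction s using Finset.induction_on_max_value f with
  | empty => simp
  | insert a s ha hmax ih =>
    rw [Finset.sum_insert ha, Finset.card_insert_of_notMem ha, harmonic_succ]
    have h1 : (insert a s).filter (fun v => f v ≤ f a) = insert a s := by
      refine Finset.filter_true_of_mem fun v hv => ?_
      rcases Finset.mem_insert.mp hv with rfl | hv
      · rfl
      · exact hmax v hv
    rw [h1, Finset.card_insert_of_notMem ha]
    have h2 : ∑ w ∈ s, (((insert a s).filter fun v => f v ≤ f w).card : ℝ)⁻¹ ≤
        ∑ w ∈ s, ((s.filter fun v => f v ≤ f w).card : ℝ)⁻¹ := by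
      refine Finset.sum_le_sum fun w hw => ?_
      have hpos : 0 < (s.filter fun v => f v ≤ f w).card :=
        Finset.card_pos.mpr ⟨w, by simp [hw]⟩
      refine inv_anti₀ (by exact_mod_cast hpos) ?_
      exact_mod_cast Finset.card_le_card (Finset.filter_subset_filter _ (Finset.subset_insert _ _))
    push_cast
    linarith

/-! ### Ball clusterings by a random order -/

/-- The first point, in the order given by `π`, of the closed `ρ`-ball around `x`. -/
noncomputable def ballCenter {X : Type*} [MetricSpace X] {n : ℕ} (π : X ≃ Fin n) (ρ : ℝ) (x : X) :
    X :=
  Function.argminOn π {w | w = x ∨ dist w x ≤ ρ} ⟨x, Or.inl rfl⟩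

theorem ballCenter_mem {X : Type*} [MetricSpace X] {n : ℕ} (π : X ≃ Fin n) (ρ : ℝ) (x : X) :
    ballCenter π ρ x = x ∨ dist (ballCenter π ρ x) x ≤ ρ :=
  Function.argminOn_mem π {w | w = x ∨ dist w x ≤ ρ} ⟨x, Or.inl rfl⟩

theorem ballCenter_le {X : Type*} [MetricSpace X] {n : ℕ} (π : X ≃ Fin n) {ρ : ℝ} {w x : X}
    (h : w = x ∨ dist w x ≤ ρ) : π (ballCenter π ρ x) ≤ π w :=
  Function.argminOn_le π {w | w = x ∨ dist w x ≤ ρ} h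

theorem ballCenter_eq_iff {X : Type*} [MetricSpace X] {n : ℕ} (π : X ≃ Fin n) (ρ : ℝ) (x y : X) :
    ballCenter π ρ x = y ↔
      (y = x ∨ dist y x ≤ ρ) ∧ ∀ w, (w = x ∨ dist w x ≤ ρ) → π y ≤ π w := by
  constructor
  · rintro rfl
    exact ⟨ballCenter_mem π ρ x, fun w => ballCenter_le π⟩
  · rintro ⟨h1, h2⟩
    exact π.injective (le_antisymm (ballCenter_le π h1) (h2 _ (ballCenter_mem π ρ x)))

theorem dist_ballCenter_le {X : Type*} [MetricSpace X] {n : ℕ} (π : X ≃ Fin n) {ρ : ℝ}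
    (hρ : 0 ≤ ρ) (x : X) : dist (ballCenter π ρ x) x ≤ ρ := by
  rcases ballCenter_mem π ρ x with h | h
  · rwa [h, dist_self]
  · exact h

theorem ballCenter_eq_self {X : Type*} [MetricSpace X] {n : ℕ} (π : X ≃ Fin n) {ρ : ℝ} {x : X}
    (h : ∀ y, y ≠ x → ρ < dist y x) : ballCenter π ρ x = x := by
  rcases ballCenter_mem π ρ x with h' | h'
  · exact h'
  · by_contra hne
    exact absurd (h _ hne) (not_lt.mpr h')

theorem ballCenter_eq_ballCenter {X : Type*} [MetricSpace X] {n : ℕ} (π : X ≃ Fin n) {ρ : ℝ}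
    (h : ∀ x y : X, dist x y ≤ ρ) (x y : X) : ballCenter π ρ x = ballCenter π ρ y :=
  (ballCenter_eq_iff π ρ x _).mpr
    ⟨Or.inr (h _ _), fun w _ => ballCenter_le π (Or.inr (h w y))⟩

/-- Each event that `x` has centre `y` is a finite Boolean combination of conditions `dist w x ≤ ρ`,
and `X → X` is finite, so any `F` is allowed. -/
theorem measurable_comp_ballCenter {X : Type*} [MetricSpace X] [Finite X] {n : ℕ} (π : X ≃ Fin n)
    (F : (X → X) → ℝ) : Measurable fun ρ => F (ballCenter π ρ) := by
  let _ : MeasurableSpace X := ⊤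
  have h1 : Measurable fun ρ : ℝ => ballCenter π ρ := by
    refine measurable_pi_iff.mpr fun x => measurable_to_countable' fun y => ?_
    have : (fun ρ : ℝ => ballCenter π ρ x) ⁻¹' {y} =
        {ρ | (y = x ∨ dist y x ≤ ρ) ∧ ∀ w, (w = x ∨ dist w x ≤ ρ) → π y ≤ π w} := by
      ext ρ; exact ballCenter_eq_iff π ρ x y
    rw [this]
    have hm : ∀ w, MeasurableSet {ρ : ℝ | w = x ∨ dist w x ≤ ρ} := fun w =>
      (MeasurableSet.const _).union measurableSet_Ici
    refine (hm y).inter (?_ : MeasurableSet {ρ | ∀ w, (w = x ∨ dist w x ≤ ρ) → π y ≤ π w})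
    exact measurableSet_setOfPred.mpr
      (Measurable.forall fun w => (measurableSet_setOfPred.mp (hm w)).imp measurable_const)
  exact (measurable_of_finite F).comp h1

theorem integrableOn_comp_ballCenter {X : Type*} [MetricSpace X] [Finite X] {n : ℕ} (π : X ≃ Fin n)
    (F : (X → X) → ℝ) {s : Set ℝ} (hs : volume s ≠ ∞) :
    IntegrableOn (fun ρ => F (ballCenter π ρ)) s := by
  obtain ⟨C, hC⟩ := (Set.finite_range fun f => ‖F f‖).bddAbove
  exact Measure.integrableOn_of_bounded (M := C) hs
    (measurable_comp_ballCenter π F).aestronglyMeasurable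
    (Filter.Eventually.of_forall fun ρ => hC ⟨_, rfl⟩)

/-- If two points get different centres, some point separates them and comes first in the order
among all points that are at least as close to the pair. -/
theorem exists_separating_of_ballCenter_ne {X : Type*} [MetricSpace X] {n : ℕ} (π : X ≃ Fin n)
    {ρ : ℝ} (hρ : 0 ≤ ρ) {u v : X} (h : ballCenter π ρ u ≠ ballCenter π ρ v) :
    ∃ w, ρ ∈ Set.Ico (min (dist w u) (dist w v)) (max (dist w u) (dist w v)) ∧
      ∀ w', min (dist w' u) (dist w' v) ≤ min (dist w u) (dist w v) → π w ≤ π w' := by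
  wlog hlt : π (ballCenter π ρ u) < π (ballCenter π ρ v) generalizing u v
  · have hlt' : π (ballCenter π ρ v) < π (ballCenter π ρ u) :=
      lt_of_le_of_ne (not_lt.mp hlt) fun e => h (π.injective e.symm)
    obtain ⟨w, h1, h2⟩ := this h.symm hlt'
    refine ⟨w, by rwa [min_comm, max_comm], fun w' hw' => h2 w' ?_⟩
    rwa [min_comm, min_comm (dist w v)]
  have hu := dist_ballCenter_le π hρ u
  have hv : ρ < dist (ballCenter π ρ u) v := by
    by_contra hcon
    exact absurd (ballCenter_le π (Or.inr (not_lt.mp hcon))) (not_le.mpr hlt)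
  -- The earlier of the two centres works: it is within `ρ` of `u`, but not of `v`, as otherwise it
  -- would precede the centre of `v` in the ball of `v`.
  refine ⟨ballCenter π ρ u, ⟨(min_le_left _ _).trans hu, hv.trans_le (le_max_right _ _)⟩, ?_⟩
  intro w' hw'
  have hw' := hw'.trans ((min_le_left _ _).trans hu)
  rcases min_le_iff.mp hw' with h' | h'
  · exact ballCenter_le π (Or.inr h')
  · exact hlt.le.trans (ballCenter_le π (Or.inr h'))

open Classical in
-- Charge each separating scale to a point `w` from `exists_separating_of_ballCenter_ne`. The scales
-- charged to `w` lie in an interval of length at most `dist u v`, and only when `w` comes first in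
-- `W w`, which has probability at most the reciprocal of `(W w).card`. These cardinalities are the
-- ranks of the points by distance to the pair, so the reciprocals sum to at most `harmonic n`.
theorem sum_integral_ballCenter_ne_le {X : Type*} [MetricSpace X] [Fintype X] {n : ℕ}
    (hn : Fintype.card X = n) {M : ℝ} (u v : X) :
    ∑ π : X ≃ Fin n, ∫ ρ in Set.Ioc 0 M,
        (if ballCenter π ρ u = ballCenter π ρ v then (0 : ℝ) else 1) ≤
      Fintype.card (X ≃ Fin n) * (harmonic n : ℚ) * dist u v := by
  set lo : X → ℝ := fun w => min (dist w u) (dist w v) with hlo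
  set hi : X → ℝ := fun w => max (dist w u) (dist w v) with hhi
  set W : X → Finset X := fun w => Finset.univ.filter fun w' => lo w' ≤ lo w with hW
  have hWw : ∀ w, w ∈ W w := fun w => by simp [hW]
  have hint : ∀ w, IntegrableOn (Set.indicator (Set.Ico (lo w) (hi w)) (1 : ℝ → ℝ))
      (Set.Ioc 0 M) := fun w =>
    (integrableOn_const (by simp) (by simp)).indicator measurableSet_Ico
  have hπ : ∀ π : X ≃ Fin n, ∫ ρ in Set.Ioc 0 M,
      (if ballCenter π ρ u = ballCenter π ρ v then (0 : ℝ) else 1) ≤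
      ∑ w, if ∀ w' ∈ W w, π w ≤ π w' then dist u v else 0 := by
    intro π
    calc ∫ ρ in Set.Ioc 0 M, (if ballCenter π ρ u = ballCenter π ρ v then (0 : ℝ) else 1)
        ≤ ∫ ρ in Set.Ioc 0 M, ∑ w, (if ∀ w' ∈ W w, π w ≤ π w' then (1 : ℝ) else 0) *
            Set.indicator (Set.Ico (lo w) (hi w)) (1 : ℝ → ℝ) ρ := by
          refine setIntegral_mono_on
            (integrableOn_comp_ballCenter π (fun f => if f u = f v then (0 : ℝ) else 1) (by simp))
            (integrable_finsetSum _ fun w _ => (hint w).const_mul _) measurableSet_Ioc ?_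
          intro ρ hρ
          have hnn : ∀ w ∈ (Finset.univ : Finset X),
              0 ≤ (if ∀ w' ∈ W w, π w ≤ π w' then (1 : ℝ) else 0) *
                Set.indicator (Set.Ico (lo w) (hi w)) (1 : ℝ → ℝ) ρ := fun w _ =>
            mul_nonneg (by split_ifs <;> simp) (Set.indicator_nonneg (fun _ _ => zero_le_one) _)
          split_ifs with h
          · exact Finset.sum_nonneg hnn
          · obtain ⟨w, h1, h2⟩ := exists_separating_of_ballCenter_ne π hρ.1.le h
            refine le_trans ?_ (Finset.single_le_sum hnn (Finset.mem_univ w))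
            have h3 : ∀ w' ∈ W w, π w ≤ π w' := fun w' hw' => h2 w' (Finset.mem_filter.mp hw').2
            rw [if_pos h3, Set.indicator_of_mem h1]
            simp
      _ = ∑ w, (if ∀ w' ∈ W w, π w ≤ π w' then (1 : ℝ) else 0) *
            ∫ ρ in Set.Ioc 0 M, Set.indicator (Set.Ico (lo w) (hi w)) (1 : ℝ → ℝ) ρ := by
          rw [integral_finsetSum _ fun w _ => (hint w).const_mul _]
          simp_rw [integral_const_mul]
      _ ≤ ∑ w, if ∀ w' ∈ W w, π w ≤ π w' then dist u v else 0 := by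
          refine Finset.sum_le_sum fun w _ => ?_
          split_ifs
          · rw [one_mul]
            have hb : hi w - lo w ≤ dist u v := by
              simp only [hlo, hhi, max_sub_min_eq_abs]
              have := abs_dist_sub_le u v w
              rwa [dist_comm u w, dist_comm v w, abs_sub_comm] at this
            calc ∫ ρ in Set.Ioc 0 M, Set.indicator (Set.Ico (lo w) (hi w)) (1 : ℝ → ℝ) ρ
                ≤ ∫ ρ, Set.indicator (Set.Ico (lo w) (hi w)) (1 : ℝ → ℝ) ρ :=
                  setIntegral_le_integral
                    ((integrable_indicator_iff measurableSet_Ico).mpr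
                      (integrableOn_const (by simp) (by simp)))
                    (Filter.Eventually.of_forall
                      (Set.indicator_nonneg fun _ _ => zero_le_one))
              _ = hi w - lo w := by
                  rw [integral_indicator_one measurableSet_Ico, Real.volume_real_Ico_of_le]
                  exact min_le_max
              _ ≤ dist u v := hb
          · simp
  calc _ ≤ ∑ π : X ≃ Fin n, ∑ w, if ∀ w' ∈ W w, π w ≤ π w' then dist u v else 0 :=
        Finset.sum_le_sum fun π _ => hπ π
    _ = ∑ w, ((Finset.univ.filter fun π : X ≃ Fin n => ∀ w' ∈ W w, π w ≤ π w').card : ℝ) *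
          dist u v := by
        rw [Finset.sum_comm]
        refine Finset.sum_congr rfl fun w _ => ?_
        rw [← Finset.sum_filter, Finset.sum_const, nsmul_eq_mul]
    _ ≤ ∑ w, (Fintype.card (X ≃ Fin n) * ((W w).card : ℝ)⁻¹) * dist u v := by
        refine Finset.sum_le_sum fun w _ => mul_le_mul_of_nonneg_right ?_ dist_nonneg
        have hpos : (0 : ℝ) < (W w).card := by exact_mod_cast Finset.card_pos.mpr ⟨w, hWw w⟩
        rw [← div_eq_mul_inv, le_div_iff₀ hpos, mul_comm]
        exact_mod_cast card_equiv_isMin (n := n) (W w) (hWw w)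
    _ = Fintype.card (X ≃ Fin n) * (∑ w, ((W w).card : ℝ)⁻¹) * dist u v := by
        rw [← Finset.sum_mul, Finset.mul_sum]
    _ ≤ _ := by
        have := sum_inv_rank_le_harmonic lo Finset.univ
        rw [Finset.card_univ, hn] at this
        gcongr

/-! ### The submodular approximation -/

theorem submodularFn_ncard_image_diff {X : Type*} [Finite X] (c : X → X) (r : X) :
    SubmodularFn fun S : Set X => (((c '' S) \ {c r}).ncard : ℝ) := by
  intro A B
  have h1 := Set.ncard_union_add_ncard_inter ((c '' A) \ {c r}) ((c '' B) \ {c r})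
  have h2 : (c '' (A ∪ B)) \ {c r} = ((c '' A) \ {c r}) ∪ ((c '' B) \ {c r}) := by
    rw [Set.image_union, Set.union_sdiff_distrib]
  have h3 : ((c '' (A ∩ B)) \ {c r}).ncard ≤
      (((c '' A) \ {c r}) ∩ ((c '' B) \ {c r})).ncard := by
    refine Set.ncard_le_ncard ?_ (Set.toFinite _)
    rintro _ ⟨⟨x, hx, rfl⟩, h⟩
    exact ⟨⟨⟨x, hx.1, rfl⟩, h⟩, ⟨⟨x, hx.2, rfl⟩, h⟩⟩
  rw [← h2] at h1
  dsimp only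
  exact_mod_cast (by omega : ((c '' (A ∪ B)) \ {c r}).ncard + ((c '' (A ∩ B)) \ {c r}).ncard ≤
    ((c '' A) \ {c r}).ncard + ((c '' B) \ {c r}).ncard)

/-- The number of clusters at scale `ρ` which meet `S`, other than the cluster of `r`, integrated
over all scales up to `M`. -/
noncomputable def clusterIntegral {X : Type*} [MetricSpace X] {n : ℕ} (M : ℝ) (r : X)
    (π : X ≃ Fin n) (S : Set X) : ℝ :=
  ∫ ρ in Set.Ioc 0 M, (((ballCenter π ρ '' S) \ {ballCenter π ρ r}).ncard : ℝ)

theorem submodularFn_clusterIntegral {X : Type*} [MetricSpace X] [Finite X] {n : ℕ} (M : ℝ)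
    (r : X) (π : X ≃ Fin n) : SubmodularFn (clusterIntegral M r π) := by
  intro A B
  have hint : ∀ S : Set X, IntegrableOn
      (fun ρ => (((ballCenter π ρ '' S) \ {ballCenter π ρ r}).ncard : ℝ)) (Set.Ioc 0 M) :=
    fun S => integrableOn_comp_ballCenter π (fun c => (((c '' S) \ {c r}).ncard : ℝ)) (by simp)
  simp only [clusterIntegral]
  rw [← integral_add (hint _) (hint _), ← integral_add (hint _) (hint _)]
  exact integral_mono ((hint _).add (hint _)) ((hint _).add (hint _)) fun ρ =>
    submodularFn_ncard_image_diff (ballCenter π ρ) r A B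

/-- Attach each `ρ`-centre to the `ρ'`-centre of the same point, at distance at most `ρ + ρ'`. If
that point lies in the root's `ρ'`-cluster, attach to `r` itself, at an extra `ρ'`. -/
theorem tspCost_image_ballCenter_le {X : Type*} [MetricSpace X] [Finite X] {n : ℕ} (π : X ≃ Fin n)
    (r : X) (S : Set X) {ρ ρ' : ℝ} (hρ : 0 ≤ ρ) (hρ' : 0 ≤ ρ') :
    tspCost r ((ballCenter π ρ '' S) \ {ballCenter π ρ r}) ≤
      tspCost r ((ballCenter π ρ' '' S) \ {ballCenter π ρ' r}) +
        2 * (ρ + 2 * ρ') * ((ballCenter π ρ '' S) \ {ballCenter π ρ r}).ncard := by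
  refine tspCost_le_add_of_near ?_
  rintro _ ⟨⟨x, hx, rfl⟩, -⟩
  have h1 := dist_ballCenter_le π hρ x
  have h2 := dist_ballCenter_le π hρ' x
  have h3 := dist_ballCenter_le π hρ' r
  have h4 := dist_triangle_right (ballCenter π ρ x) (ballCenter π ρ' x) x
  by_cases h : ballCenter π ρ' x = ballCenter π ρ' r
  · refine ⟨r, Set.mem_insert _ _, ?_⟩
    have := dist_triangle (ballCenter π ρ x) (ballCenter π ρ' x) r
    rw [h] at this h4 h2
    linarith
  · exact ⟨ballCenter π ρ' x, Set.mem_insert_of_mem _ ⟨⟨x, hx, rfl⟩, h⟩, by linarith⟩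

theorem tspCost_le_clusterIntegral {X : Type*} [MetricSpace X] [Finite X] {n : ℕ} {M : ℝ}
    (hM : 0 < M) (hdiam : ∀ x y : X, dist x y ≤ M / 2) (r : X) (π : X ≃ Fin n) (S : Set X) :
    tspCost r S ≤ 20 * clusterIntegral M r π S := by
  set h : ℝ → ℝ := fun ρ => (((ballCenter π ρ '' S) \ {ballCenter π ρ r}).ncard : ℝ) with hh
  set T : ℝ → ℝ := fun ρ => tspCost r ((ballCenter π ρ '' S) \ {ballCenter π ρ r}) with hT
  have hint : ∀ a b : ℝ, IntegrableOn h (Set.Ioc a b) := fun a b =>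
    integrableOn_comp_ballCenter π (fun c => (((c '' S) \ {c r}).ncard : ℝ)) (by simp)
  have hnn : ∀ s : Set ℝ, 0 ≤ ∫ ρ in s, h ρ := fun s =>
    integral_nonneg fun ρ => Nat.cast_nonneg _
  -- One scale is chosen in each dyadic interval, from coarse to fine; at scale `M` there is a
  -- single cluster and the cost is 0.
  have key : ∀ i : ℕ, ∃ ρ ∈ Set.Ioc (M / 2 ^ (i + 1)) (M / 2 ^ i),
      T ρ ≤ 20 * ∫ ρ in Set.Ioc (M / 2 ^ (i + 1)) M, h ρ := by
    intro i
    induction i with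
    | zero =>
      refine ⟨M, ⟨by norm_num; linarith, by simp⟩, ?_⟩
      refine le_trans ?_ (mul_nonneg (by norm_num) (hnn _))
      refine tspCost_le_of_subset_root ?_
      rintro _ ⟨⟨x, -, rfl⟩, hx⟩
      exact absurd (ballCenter_eq_ballCenter π (fun x y => (hdiam x y).trans (by linarith)) x r) hx
    | succ i ih =>
      obtain ⟨ρ', hρ', hTρ'⟩ := ih
      set a := M / 2 ^ (i + 1) with ha
      have hapos : 0 < a := by positivity
      have e1 : M / 2 ^ (i + 1 + 1) = a / 2 := by rw [ha, pow_succ _ (i + 1)]; field_simp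
      have e2 : M / 2 ^ i = 2 * a := by rw [ha, pow_succ]; field_simp
      have haM : a ≤ M := div_le_self hM.le (one_le_pow₀ (by norm_num))
      rw [e1]
      rw [e2] at hρ'
      have hvol : volume (Set.Ioc (a / 2) a) ≠ 0 := by
        rw [Real.volume_Ioc]
        simpa using hapos
      -- At a scale where `h` is at most its average, `(a / 2) * h ρ` is at most the integral over
      -- the interval. With `ρ ≤ a` and `ρ' ≤ 2 * a` the new connections cost at most `10 * a * h
      -- ρ`, which gives the factor 20.
      obtain ⟨ρ, hρ, havg⟩ := exists_le_setAverage hvol (by simp) (hint (a / 2) a)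
      refine ⟨ρ, hρ, ?_⟩
      rw [setAverage_eq, Real.volume_real_Ioc_of_le (by linarith), smul_eq_mul,
        ← div_eq_inv_mul, le_div_iff₀ (by linarith)] at havg
      have hstep := tspCost_image_ballCenter_le π r S (ρ := ρ) (ρ' := ρ')
        (by linarith [hρ.1]) (by linarith [hρ'.1])
      change T ρ ≤ T ρ' + 2 * (ρ + 2 * ρ') * h ρ at hstep
      have h0 : 0 ≤ h ρ := Nat.cast_nonneg _
      have h5 : 2 * (ρ + 2 * ρ') * h ρ ≤ 10 * a * h ρ :=
        mul_le_mul_of_nonneg_right (by linarith [hρ.2, hρ'.2]) h0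
      have hsplit : ∫ ρ in Set.Ioc (a / 2) M, h ρ =
          (∫ ρ in Set.Ioc (a / 2) a, h ρ) + ∫ ρ in Set.Ioc a M, h ρ := by
        rw [← Set.Ioc_union_Ioc_eq_Ioc (by linarith : a / 2 ≤ a) haM]
        exact setIntegral_union (Set.Ioc_disjoint_Ioc_of_le le_rfl) measurableSet_Ioc
          (hint _ _) (hint _ _)
      rw [hsplit]
      linarith
  have hsmall : ∃ ε > 0, ∀ x y : X, y ≠ x → ε ≤ dist y x := by
    have : ∀ᶠ ε : ℝ in nhdsWithin 0 (Set.Ioi 0), ∀ x y : X, y ≠ x → ε ≤ dist y x := by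
      simp only [Filter.eventually_all]
      exact fun x y hxy => (eventually_le_nhds (dist_pos.mpr hxy)).filter_mono nhdsWithin_le_nhds
    obtain ⟨ε, h, hε⟩ := (this.and self_mem_nhdsWithin).exists
    exact ⟨ε, hε, h⟩
  -- Below the minimum distance every point is its own centre, so the chosen scale recovers `S` up
  -- to the root.
  obtain ⟨ε, hε, hsep⟩ := hsmall
  obtain ⟨i, hi⟩ := exists_pow_lt_of_lt_one (div_pos hε hM) (by norm_num : (1 / 2 : ℝ) < 1)
  obtain ⟨ρ, hρ, hTρ⟩ := key i
  have hρε : ρ < ε := by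
    refine hρ.2.trans_lt ?_
    rw [lt_div_iff₀ hM] at hi
    calc M / 2 ^ i = (1 / 2) ^ i * M := by rw [one_div, inv_pow]; field_simp
      _ < ε := hi
  have hid : ballCenter π ρ = id :=
    funext fun x => ballCenter_eq_self π fun y hy => hρε.trans_le (hsep x y hy)
  have h6 : tspCost r S ≤ T ρ := by
    simp only [hT, hid]
    rw [Set.image_id]
    refine le_trans (tspCost_mono r ?_) (tspCost_insert_root_le r (S \ {r}))
    simp
  refine h6.trans (hTρ.trans (mul_le_mul_of_nonneg_left ?_ (by norm_num)))
  refine setIntegral_mono_set (hint 0 M) (Filter.Eventually.of_forall fun ρ => Nat.cast_nonneg _) ?_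
  exact (Set.Ioc_subset_Ioc_left (by positivity)).eventuallyLE

open Classical in
-- Walk along the tour, moving the root from each point to the next: the count drops by at most one,
-- and only at scales separating the two.
theorem sum_clusterIntegral_le {X : Type*} [MetricSpace X] [Fintype X] {n : ℕ}
    (hn : Fintype.card X = n) (M : ℝ) (l : List X) : ∀ (r : X) (S : Set X),
      (∀ s ∈ S, s ∈ r :: l) →
      ∑ π : X ≃ Fin n, clusterIntegral M r π S ≤
        Fintype.card (X ≃ Fin n) * (harmonic n : ℚ) * walkLength (r :: l) := by
  induction l with
  | nil =>
    intro r S hS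
    have : ∀ π : X ≃ Fin n, clusterIntegral M r π S = 0 := by
      intro π
      have h0 : ∀ ρ, (ballCenter π ρ '' S) \ {ballCenter π ρ r} = ∅ := by
        intro ρ
        rw [Set.sdiff_eq_empty]
        rintro _ ⟨x, hx, rfl⟩
        have := hS x hx
        simp at this
        simp [this]
      simp [clusterIntegral, h0]
    simp [this, walkLength]
  | cons y l ih =>
    intro r S hS
    have h1 := ih y (S \ {r}) fun s hs => by
      have := hS s hs.1
      simpa [show s ≠ r from hs.2] using this
    have h2 := sum_integral_ballCenter_ne_le hn (M := M) r y
    have h3 : ∀ π : X ≃ Fin n, clusterIntegral M r π S ≤ clusterIntegral M y π (S \ {r}) +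
        ∫ ρ in Set.Ioc 0 M, (if ballCenter π ρ r = ballCenter π ρ y then (0 : ℝ) else 1) := by
      intro π
      have hi1 : ∀ (S : Set X) (r : X), IntegrableOn
          (fun ρ => (((ballCenter π ρ '' S) \ {ballCenter π ρ r}).ncard : ℝ)) (Set.Ioc 0 M) :=
        fun S r => integrableOn_comp_ballCenter π (fun c => (((c '' S) \ {c r}).ncard : ℝ))
          (by simp)
      have hi2 : IntegrableOn
          (fun ρ => (if ballCenter π ρ r = ballCenter π ρ y then (0 : ℝ) else 1)) (Set.Ioc 0 M) :=
        integrableOn_comp_ballCenter π (fun c => if c r = c y then (0 : ℝ) else 1) (by simp)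
      simp only [clusterIntegral]
      rw [← integral_add (hi1 _ _) hi2]
      refine integral_mono (hi1 _ _) ((hi1 _ _).add hi2) fun ρ => ?_
      set c := ballCenter π ρ
      dsimp only
      have hsub : (c '' S) \ {c r} ⊆ insert (c y) ((c '' (S \ {r})) \ {c y}) := by
        rintro _ ⟨⟨x, hx, rfl⟩, hxr⟩
        by_cases hxy : c x = c y
        · exact Or.inl hxy
        · exact Or.inr ⟨⟨x, ⟨hx, fun e => hxr (by rw [Set.mem_singleton_iff] at e ⊢; rw [e])⟩, rfl⟩, hxy⟩
      split_ifs with hc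
      · have : (c '' S) \ {c r} ⊆ (c '' (S \ {r})) \ {c y} := fun z hz =>
          (hsub hz).resolve_left fun e => hz.2 (by rw [e, hc]; rfl)
        simpa using Set.ncard_le_ncard this (Set.toFinite _)
      · have := (Set.ncard_le_ncard hsub (Set.toFinite _)).trans (Set.ncard_insert_le _ _)
        exact_mod_cast this
    calc _ ≤ ∑ π : X ≃ Fin n, (clusterIntegral M y π (S \ {r}) + ∫ ρ in Set.Ioc 0 M,
            (if ballCenter π ρ r = ballCenter π ρ y then (0 : ℝ) else 1)) :=
          Finset.sum_le_sum fun π _ => h3 π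
      _ ≤ _ := by
          rw [Finset.sum_add_distrib]
          simp only [walkLength]
          linarith

theorem submodularApprox_tspCost {X : Type*} [MetricSpace X] [Fintype X] (r : X) :
    SubmodularApprox (fun S : Set X => tspCost r S)
      (20 * (1 + Real.log (Fintype.card X))) := by
  classical
  obtain ⟨n, hn⟩ : ∃ n, Fintype.card X = n := ⟨_, rfl⟩
  obtain ⟨D, hD⟩ := (Set.finite_range fun p : X × X => dist p.1 p.2).bddAbove
  have hD' : ∀ x y : X, dist x y ≤ D := fun x y => hD ⟨(x, y), rfl⟩
  have hD0 : 0 ≤ D := dist_nonneg.trans (hD' r r)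
  -- This makes `D ≤ M / 2`, with `M` positive even for a one-point space.
  set M := 2 * D + 1 with hM
  set N : ℝ := (Fintype.card (X ≃ Fin n) : ℝ) with hN
  have hNpos : 0 < N := by
    have : Nonempty (X ≃ Fin n) := ⟨Fintype.equivFinOfCardEq hn⟩
    exact Nat.cast_pos.mpr Fintype.card_pos
  refine ⟨fun S => 20 / N * ∑ π : X ≃ Fin n, clusterIntegral M r π S, ?_, fun S => ⟨?_, ?_⟩⟩
  · intro A B
    dsimp only
    rw [← mul_add, ← mul_add, ← Finset.sum_add_distrib, ← Finset.sum_add_distrib]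
    refine mul_le_mul_of_nonneg_left ?_ (by positivity)
    exact Finset.sum_le_sum fun π _ => submodularFn_clusterIntegral M r π A B
  · have : ∑ π : X ≃ Fin n, tspCost r S ≤ ∑ π : X ≃ Fin n, 20 * clusterIntegral M r π S :=
      Finset.sum_le_sum fun π _ => tspCost_le_clusterIntegral (by linarith)
        (fun x y => (hD' x y).trans (by linarith)) r π S
    rw [Finset.sum_const, Finset.card_univ, nsmul_eq_mul, ← Finset.mul_sum, mul_comm] at this
    dsimp only
    rw [div_mul_eq_mul_div, le_div_iff₀ hNpos]
    exact this
  · have hlog : (0 : ℝ) < 20 * (1 + Real.log n) := by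
      have := Real.log_natCast_nonneg n
      linarith
    dsimp only
    rw [hn, ← div_le_iff₀' hlog]
    refine le_tspCost fun l hl => ?_
    rw [div_le_iff₀' hlog, div_mul_eq_mul_div, div_le_iff₀ hNpos]
    have h1 := sum_clusterIntegral_le hn M (l ++ [r]) r S fun s hs => by
      have := hl s hs
      simp at this ⊢
      tauto
    have h2 := harmonic_le_one_add_log n
    have h3 := walkLength_nonneg (r :: (l ++ [r]))
    calc 20 * ∑ π : X ≃ Fin n, clusterIntegral M r π S
        ≤ 20 * (N * (harmonic n : ℚ) * walkLength (r :: (l ++ [r]))) := by gcongr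
      _ ≤ 20 * (N * (1 + Real.log n) * walkLength (r :: (l ++ [r]))) := by gcongr
      _ = _ := by ring

theorem submodularityGap_tspCost_le {X : Type*} [MetricSpace X] [Fintype X] (r : X)
    (hX : 2 ≤ Fintype.card X) :
    submodularityGap (fun S : Set X => tspCost r S) ≤
      ENNReal.ofReal (60 * Real.log (Fintype.card X)) := by
  have h2 : (2 : ℝ) ≤ Fintype.card X := by exact_mod_cast hX
  have hlog : 1 / 2 ≤ Real.log (Fintype.card X) :=
    (by linarith [Real.log_two_gt_d9] : (1 / 2 : ℝ) ≤ Real.log 2).trans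
      (Real.log_le_log (by norm_num) h2)
  obtain ⟨lam, hlam⟩ : ∃ lam : ℝ≥0, (lam : ℝ) = 20 * (1 + Real.log (Fintype.card X)) :=
    ⟨⟨_, by positivity⟩, rfl⟩
  refine (iInf₂_le lam (by rw [hlam]; exact submodularApprox_tspCost r)).trans ?_
  rw [← ENNReal.ofReal_coe_nnreal, hlam]
  exact ENNReal.ofReal_le_ofReal (by linarith)

/-! ### Sawtooth paths -/

/-- The distance from `t` to the nearest multiple of `2⁻ⁱ`. -/
noncomputable def sawtooth (i : ℕ) (t : ℝ) : ℝ :=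
  Metric.infDist t (Set.range fun m : ℤ => (m : ℝ) / 2 ^ i)

theorem abs_sawtooth_sub_le (i : ℕ) (t t' : ℝ) : |sawtooth i t - sawtooth i t'| ≤ |t - t'| := by
  have := (Metric.lipschitz_infDist_pt (Set.range fun m : ℤ => (m : ℝ) / 2 ^ i)).dist_le_mul t t'
  simpa [Real.dist_eq, sawtooth] using this

theorem sawtooth_eq_zero {i j : ℕ} (h : j ≤ i) (m : ℤ) : sawtooth i (m / 2 ^ j) = 0 := by
  refine Metric.infDist_zero_of_mem ⟨m * 2 ^ (i - j), ?_⟩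
  obtain ⟨d, rfl⟩ := Nat.exists_eq_add_of_le h
  push_cast
  rw [Nat.add_sub_cancel_left, pow_add]
  field_simp

theorem le_sawtooth {i j : ℕ} (h : i ≤ j) (a : ℤ) :
    1 / 2 ^ (j + 1) ≤ sawtooth i ((2 * a + 1) / 2 ^ (j + 1)) := by
  refine (Metric.le_infDist (Set.range_nonempty _)).mpr ?_
  rintro _ ⟨m, rfl⟩
  obtain ⟨d, rfl⟩ := Nat.exists_eq_add_of_le h
  have e : ((2 * a + 1) / 2 ^ (i + d + 1) - m / 2 ^ i : ℝ) =
      ((2 * a + 1 - 2 * (m * 2 ^ d) : ℤ) : ℝ) / 2 ^ (i + d + 1) := by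
    push_cast
    rw [pow_succ, pow_add]
    field_simp
  rw [Real.dist_eq, e, abs_div, abs_of_pos (by positivity : (0 : ℝ) < 2 ^ (i + d + 1))]
  refine div_le_div_of_nonneg_right ?_ (by positivity)
  have : (1 : ℤ) ≤ |2 * a + 1 - 2 * (m * 2 ^ d)| := Int.one_le_abs (by omega)
  exact_mod_cast this

/-- The path with index `s` at time `t`: its `i`-th coordinate is the sawtooth function of scale
`2⁻ⁱ`, reflected if the `i`-th binary digit of `s` is zero. -/
noncomputable def sawtoothPath (k s : ℕ) (t : ℝ) : ℝ × (Fin k → ℝ) :=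
  (t, fun i => if s.testBit i then sawtooth i t else -sawtooth i t)

theorem dist_sawtoothPath_le (k s : ℕ) (t t' : ℝ) :
    dist (sawtoothPath k s t) (sawtoothPath k s t') ≤ |t - t'| := by
  refine max_le (Real.dist_eq _ _).le ((dist_pi_le_iff (abs_nonneg _)).mpr fun i => ?_)
  have h := abs_sawtooth_sub_le i t t'
  simp only [sawtoothPath, Real.dist_eq]
  split_ifs
  · exact h
  · rwa [neg_sub_neg, abs_sub_comm]

theorem le_dist_sawtoothPath (k s s' : ℕ) (t t' : ℝ) :
    |t - t'| ≤ dist (sawtoothPath k s t) (sawtoothPath k s' t') :=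
  (Real.dist_eq _ _).ge.trans (le_max_left _ _)

theorem sawtoothPath_zero (k s : ℕ) : sawtoothPath k s 0 = 0 := by
  have h : ∀ i, sawtooth i 0 = 0 := fun i => by
    simpa using sawtooth_eq_zero (Nat.zero_le i) 0
  ext <;> simp [sawtoothPath, h]

/-- At this time all sawtooth coordinates with index above `j` vanish, so the higher bits of the
index have no effect and paths merge. -/
theorem sawtoothPath_add (k j q s : ℕ) (hs : s < 2 ^ (j + 1)) (a : ℤ) :
    sawtoothPath k (2 ^ (j + 1) * q + s) ((2 * a + 1) / 2 ^ (j + 1)) =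
      sawtoothPath k s ((2 * a + 1) / 2 ^ (j + 1)) := by
  refine Prod.ext rfl (funext fun i => ?_)
  simp only [sawtoothPath, Nat.testBit_two_pow_mul_add q hs]
  by_cases hi : (i : ℕ) < j + 1
  · simp [hi]
  · have : sawtooth i ((2 * a + 1) / 2 ^ (j + 1)) = 0 := by
      simpa using sawtooth_eq_zero (not_lt.mp hi) (2 * a + 1)
    simp [this]

/-- Different times are separated by the first coordinate. At equal times, a differing bit `i ≤ j`
gives opposite signs to a coordinate of size at least `1 / 2 ^ (j + 1)`. -/
theorem one_div_le_dist_sawtoothPath {k j s s' : ℕ} (hj : j < k) (hs : s < 2 ^ (j + 1))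
    (hs' : s' < 2 ^ (j + 1)) {a a' : ℤ} (h : (a, s) ≠ (a', s')) :
    1 / 2 ^ (j + 1) ≤ dist (sawtoothPath k s ((2 * a + 1) / 2 ^ (j + 1)))
      (sawtoothPath k s' ((2 * a' + 1) / 2 ^ (j + 1))) := by
  by_cases ha : a = a'
  · subst ha
    have hss : s ≠ s' := fun e => h (by rw [e])
    obtain ⟨i, hi⟩ : ∃ i, s.testBit i ≠ s'.testBit i := by
      by_contra! hcon
      exact hss (Nat.eq_of_testBit_eq hcon)
    have hij : i ≤ j := by
      by_contra hcon
      have : 2 ^ (j + 1) ≤ 2 ^ i := Nat.pow_le_pow_right (by norm_num) (by omega)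
      exact hi (by rw [Nat.testBit_lt_two_pow (hs.trans_le this),
        Nat.testBit_lt_two_pow (hs'.trans_le this)])
    have h1 := le_sawtooth hij a
    have h0 : (0 : ℝ) < 1 / 2 ^ (j + 1) := by positivity
    refine le_trans ?_ ((dist_le_pi_dist (sawtoothPath k s ((2 * a + 1) / 2 ^ (j + 1))).2
      (sawtoothPath k s' ((2 * a + 1) / 2 ^ (j + 1))).2 ⟨i, by omega⟩).trans (le_max_right _ _))
    simp only [sawtoothPath, Real.dist_eq]
    split_ifs with h2 h3 h3
    · exact absurd (h2.trans h3.symm) hi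
    · rw [sub_neg_eq_add, abs_of_nonneg (by linarith)]; linarith
    · rw [← neg_add', abs_neg, abs_of_nonneg (by linarith)]; linarith
    · exact absurd ((Bool.eq_false_iff.mpr h2).trans (Bool.eq_false_iff.mpr h3).symm) hi
  · refine le_trans ?_ (le_dist_sawtoothPath k s s' _ _)
    rw [← sub_div, abs_div, abs_of_pos (by positivity : (0 : ℝ) < 2 ^ (j + 1))]
    refine div_le_div_of_nonneg_right ?_ (by positivity)
    have : (1 : ℤ) ≤ |2 * a + 1 - (2 * a' + 1)| := Int.one_le_abs (by omega)
    exact_mod_cast this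

/-! ### The lower bound for sawtooth spaces -/

theorem tspCost_le_of_chain {X : Type*} [MetricSpace X] [Finite X] (p : ℕ → X) {δ : ℝ}
    (h : ∀ a, dist (p (a + 1)) (p a) ≤ δ) (N : ℕ) :
    tspCost (p 0) (p '' Set.Iic N) ≤ 2 * δ * N := by
  induction N with
  | zero =>
    simpa using tspCost_le_of_subset_root (r := p 0) (S := p '' Set.Iic 0) (by simp)
  | succ N ih =>
    have h1 : p '' Set.Iic (N + 1) = insert (p (N + 1)) (p '' Set.Iic N) := by
      rw [← Set.image_insert_eq]
      congr 1
      ext a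
      simp only [Set.mem_Iic, Set.mem_insert_iff]
      omega
    have h2 := tspCost_insert_le (r := p 0) (a := p (N + 1)) (S := p '' Set.Iic N) (z := p N)
      (Set.mem_insert_of_mem _ ⟨N, Set.mem_Iic.mpr le_rfl, rfl⟩)
    rw [h1]
    push_cast
    linarith [h N]

/-- Each dyadic block of `2 ^ i` indices, from `2 ^ i` on, adds at least `2 ^ i * 2 ^ (K - (i +
1))`, half of `2 ^ K`. -/
theorem two_mul_sum_ge_of_dyadic {h : ℕ → ℝ} {K : ℕ}
    (hh : ∀ i ≤ K, ∀ m < 2 ^ i, (2 : ℝ) ^ (K - i) ≤ h m) (i : ℕ) (hi : i ≤ K) :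
    (i + 2) * 2 ^ K ≤ 2 * ∑ m ∈ Finset.range (2 ^ i), h m := by
  induction i with
  | zero =>
    have := hh 0 hi 0 (by norm_num)
    simp at this ⊢
    linarith
  | succ i ih =>
    have h1 := ih (by omega)
    have h2 : ∑ m ∈ Finset.range (2 ^ i), (2 : ℝ) ^ (K - (i + 1)) ≤
        ∑ m ∈ Finset.range (2 ^ i), h (2 ^ i + m) := by
      refine Finset.sum_le_sum fun m hm => hh (i + 1) hi _ ?_
      rw [Finset.mem_range] at hm
      rw [pow_succ]
      omega
    rw [Finset.sum_const, Finset.card_range, nsmul_eq_mul] at h2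
    have h3 : ((2 ^ i : ℕ) : ℝ) * 2 ^ (K - (i + 1)) * 2 = 2 ^ K := by
      push_cast
      rw [mul_assoc, ← pow_succ, ← pow_add]
      congr 1
      omega
    rw [pow_succ 2 i, mul_two, Finset.sum_range_add]
    push_cast
    linarith

/-- The finite set of all vertices of the sawtooth paths with steps of length `2⁻ᵏ`. -/
noncomputable def sawtoothVertices (k : ℕ) : Finset (ℝ × (Fin k → ℝ)) :=
  open Classical in
  (Finset.range (2 ^ k) ×ˢ Finset.range (2 ^ k + 1)).image fun q =>
    sawtoothPath k q.1 ((q.2 : ℝ) / 2 ^ k)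

theorem card_sawtoothVertices_le (k : ℕ) : (sawtoothVertices k).card ≤ 2 * 4 ^ k := by
  classical
  refine Finset.card_image_le.trans ?_
  rw [Finset.card_product, Finset.card_range, Finset.card_range,
    show 4 = 2 * 2 from rfl, mul_pow]
  nlinarith [Nat.one_le_two_pow (n := k)]

/-- Only the presence of the sawtooth vertices is required, so that the space can be padded to any
larger number of points. -/
theorem le_of_submodularApprox_tspCost {X : Type*} [MetricSpace X] [Finite X] {k : ℕ} (hk : 1 ≤ k)
    (ι : X → ℝ × (Fin k → ℝ)) (hι : Isometry ι) (hV : ∀ v ∈ sawtoothVertices k, ∃ x, ι x = v)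
    {r : X} (hr : ι r = 0) {lam : ℝ}
    (hlam : SubmodularApprox (fun S : Set X => tspCost r S) lam) : (k + 1) / 8 ≤ lam := by
  classical
  obtain ⟨g, hg, hfg⟩ := hlam
  -- a parametrization of the paths, which is constant after time one
  have hp : ∀ s < 2 ^ k, ∃ p : ℕ → X, ∀ a,
      ι (p a) = sawtoothPath k s ((min a (2 ^ k) : ℕ) / 2 ^ k) := by
    intro s hs
    refine Classical.skolem.mp fun a => hV _ (Finset.mem_image.mpr
      ⟨(s, min a (2 ^ k)), ?_, rfl⟩)
    simp only [Finset.mem_product, Finset.mem_range]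
    omega
  have : Nonempty X := ⟨r⟩
  choose! p hp using hp
  set P : ℕ → Set X := fun s => p s '' Set.Iic (2 ^ k) with hP
  have hcost : ∀ s < 2 ^ k, tspCost r (P s) ≤ 2 := by
    intro s hs
    have h0 : p s 0 = r := hι.injective (by rw [hp s hs, hr]; simpa using sawtoothPath_zero k s)
    have h1 := tspCost_le_of_chain (p s) (δ := 1 / 2 ^ k) (fun a => by
      rw [← hι.dist_eq, hp s hs, hp s hs]
      refine (dist_sawtoothPath_le _ _ _ _).trans ?_
      rw [← sub_div, abs_div, abs_of_pos (by positivity : (0 : ℝ) < 2 ^ k)]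
      refine div_le_div_of_nonneg_right ?_ (by positivity)
      rw [abs_le]
      have h2 : min (a + 1) (2 ^ k) ≤ min a (2 ^ k) + 1 := by omega
      have h3 : min a (2 ^ k) ≤ min (a + 1) (2 ^ k) := by omega
      have h2' : ((min (a + 1) (2 ^ k) : ℕ) : ℝ) ≤ (min a (2 ^ k) : ℕ) + 1 := by exact_mod_cast h2
      have h3' : ((min a (2 ^ k) : ℕ) : ℝ) ≤ (min (a + 1) (2 ^ k) : ℕ) := by exact_mod_cast h3
      constructor <;> linarith) (2 ^ k)
    rw [h0] at h1
    refine h1.trans (le_of_eq ?_)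
    push_cast
    field_simp
  set L : ℕ → Set X := fun m =>
    {x | m + 1 ≤ {s ∈ ((Finset.range (2 ^ k) : Finset ℕ) : Set ℕ) | x ∈ P s}.ncard} with hL
  have hlev : ∀ j < k, ∀ m < 2 ^ (k - 1 - j), (2 : ℝ) ^ j ≤ tspCost r (L m) := by
    intro j hj m hm
    have hq : ∀ a : ℕ, a < 2 ^ j → ∀ s < 2 ^ (j + 1), ∃ x, x ∈ L m ∧
        ι x = sawtoothPath k s ((2 * (a : ℤ) + 1) / 2 ^ (j + 1)) := by
      intro a ha s hs
      have hjk : (2 : ℕ) ^ k = 2 ^ (j + 1) * 2 ^ (k - 1 - j) := by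
        rw [← pow_add]; congr 1; omega
      have hs' : ∀ q < 2 ^ (k - 1 - j), 2 ^ (j + 1) * q + s < 2 ^ k := by
        intro q hq
        rw [hjk]
        nlinarith
      -- The step number, in units of `2⁻ᵏ`, of the time `(2 * a + 1) / 2 ^ (j + 1)`.
      set b := (2 * a + 1) * 2 ^ (k - 1 - j) with hb
      have hbk : b ≤ 2 ^ k := by
        rw [hjk, hb]
        refine Nat.mul_le_mul_right _ ?_
        rw [pow_succ]
        omega
      have htime : ((min b (2 ^ k) : ℕ) : ℝ) / 2 ^ k = (2 * (a : ℤ) + 1) / 2 ^ (j + 1) := by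
        rw [min_eq_left hbk, hb, show (2 : ℝ) ^ k = 2 ^ (j + 1) * 2 ^ (k - 1 - j) by
          exact_mod_cast hjk]
        push_cast
        field_simp
      have hx : ∀ q < 2 ^ (k - 1 - j), ι (p (2 ^ (j + 1) * q + s) b) =
          sawtoothPath k s ((2 * (a : ℤ) + 1) / 2 ^ (j + 1)) := by
        intro q hq
        rw [hp _ (hs' q hq), htime, sawtoothPath_add k j q s hs]
      have h0 : 0 < 2 ^ (k - 1 - j) := by positivity
      refine ⟨p (2 ^ (j + 1) * 0 + s) b, ?_, hx 0 h0⟩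
      -- All indices `2 ^ (j + 1) * q + s` give paths through this vertex.
      have hcard : 2 ^ (k - 1 - j) ≤ {s' ∈ ((Finset.range (2 ^ k) : Finset ℕ) : Set ℕ) |
          p (2 ^ (j + 1) * 0 + s) b ∈ P s'}.ncard := by
        have hinj : Function.Injective fun q : ℕ => 2 ^ (j + 1) * q + s := by
          intro q q' h
          have : 2 ^ (j + 1) * q = 2 ^ (j + 1) * q' := by simpa using h
          exact Nat.eq_of_mul_eq_mul_left (by positivity) this
        rw [← Finset.card_range (2 ^ (k - 1 - j)), ← Finset.card_image_of_injective _ hinj,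
          ← Set.ncard_coe_finset]
        refine Set.ncard_le_ncard ?_ ((Finset.finite_toSet _).subset fun _ h => h.1)
        intro s' h
        obtain ⟨q, hq, rfl⟩ := Finset.mem_image.mp (Finset.mem_coe.mp h)
        rw [Finset.mem_range] at hq
        refine ⟨by simpa using hs' q hq, b, hbk, ?_⟩
        exact hι.injective ((hx q hq).trans (hx 0 h0).symm)
      exact (Nat.succ_le_of_lt hm).trans hcard
    choose! y hyL hy using hq
    set I := Finset.range (2 ^ j) ×ˢ Finset.range (2 ^ (j + 1)) with hI
    have hsep : ∀ u ∈ I, ∀ v ∈ I, u ≠ v → 1 / 2 ^ (j + 1) ≤ dist (y u.1 u.2) (y v.1 v.2) := by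
      rintro ⟨a, s⟩ hu ⟨a', s'⟩ hv huv
      simp only [hI, Finset.mem_product, Finset.mem_range] at hu hv
      rw [← hι.dist_eq, hy _ hu.1 _ hu.2, hy _ hv.1 _ hv.2]
      refine one_div_le_dist_sawtoothPath hj hu.2 hv.2 fun h => huv ?_
      simpa using h
    have hroot : ∀ u ∈ I, 1 / 2 ^ (j + 1) ≤ dist r (y u.1 u.2) := by
      rintro ⟨a, s⟩ hu
      simp only [hI, Finset.mem_product, Finset.mem_range] at hu
      rw [← hι.dist_eq, hy _ hu.1 _ hu.2, hr, ← sawtoothPath_zero k s]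
      refine le_trans ?_ (le_dist_sawtoothPath _ _ _ _ _)
      rw [zero_sub, abs_neg, abs_of_nonneg (by positivity)]
      refine div_le_div_of_nonneg_right ?_ (by positivity)
      have : (0 : ℝ) ≤ a := Nat.cast_nonneg a
      push_cast
      linarith
    have hpos : (0 : ℝ) < 1 / 2 ^ (j + 1) := by positivity
    have hinj : Set.InjOn (fun u : ℕ × ℕ => y u.1 u.2) I := by
      intro u hu v hv h
      by_contra huv
      have := hsep u hu v hv huv
      dsimp only at h
      rw [h, dist_self] at this
      linarith
    have hE := card_mul_le_tspCost (r := r) (S := L m) (δ := 1 / 2 ^ (j + 1))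
      (I.image fun u => y u.1 u.2)
      (fun h => by
        obtain ⟨u, hu, h⟩ := Finset.mem_image.mp h
        have := hroot u hu
        rw [h, dist_self] at this
        linarith)
      (fun x hx => by
        obtain ⟨u, hu, rfl⟩ := Finset.mem_image.mp hx
        simp only [hI, Finset.mem_product, Finset.mem_range] at hu
        exact hyL _ hu.1 _ hu.2)
      (by
        intro u hu v hv huv
        simp only [Finset.mem_insert, Finset.mem_image] at hu hv
        rcases hu with rfl | ⟨u, hu, rfl⟩ <;> rcases hv with rfl | ⟨v, hv, rfl⟩
        · exact absurd rfl huv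
        · exact hroot v hv
        · rw [dist_comm]; exact hroot u hu
        · exact hsep u hu v hv fun e => huv (by rw [e]))
    rw [Finset.card_image_of_injOn hinj, hI, Finset.card_product, Finset.card_range,
      Finset.card_range] at hE
    refine le_trans (le_of_eq ?_) hE
    push_cast
    field_simp
  obtain ⟨K, rfl⟩ : ∃ K, k = K + 1 := ⟨k - 1, by omega⟩
  have h1 := two_mul_sum_ge_of_dyadic (h := fun m => tspCost r (L m)) (K := K)
    (fun i hi m hm => hlev (K - i) (by omega) m (by
      rwa [show K + 1 - 1 - (K - i) = i by omega])) K le_rfl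
  have h2 : ∑ m ∈ Finset.range (2 ^ K), tspCost r (L m) ≤
      ∑ m ∈ Finset.range (2 ^ (K + 1)), g (L m) :=
    (Finset.sum_le_sum_of_subset_of_nonneg
      (Finset.range_mono (Nat.pow_le_pow_right (by norm_num) (Nat.le_succ K)))
      fun m _ _ => tspCost_nonneg r _).trans (Finset.sum_le_sum fun m _ => (hfg (L m)).1)
  have h3 := hg.sum_levelSets_le P (Finset.range (2 ^ (K + 1)))
  rw [Finset.card_range] at h3
  -- Here `lam` is an arbitrary real; a level set of positive cost rules out negative values.
  have hlam0 : 0 ≤ lam := by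
    have hpos : 0 < tspCost r (L 0) :=
      lt_of_lt_of_le (by positivity) (hlev 0 (by omega) 0 (by positivity))
    have := (hfg (L 0)).1.trans (hfg (L 0)).2
    by_contra hneg
    nlinarith
  have h4 : ∑ s ∈ Finset.range (2 ^ (K + 1)), g (P s) ≤
      ∑ s ∈ Finset.range (2 ^ (K + 1)), lam * 2 :=
    Finset.sum_le_sum fun s hs => (hfg (P s)).2.trans
      (mul_le_mul_of_nonneg_left (hcost s (Finset.mem_range.mp hs)) hlam0)
  rw [Finset.sum_const, Finset.card_range, nsmul_eq_mul] at h4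
  push_cast at h4 ⊢
  have h5 : ((K : ℝ) + 2) * 2 ^ K ≤ 8 * lam * 2 ^ K := by
    have h6 := h2.trans (h3.trans h4)
    rw [pow_succ (2 : ℝ)] at h6
    linarith
  linarith [le_of_mul_le_mul_right h5 (by positivity)]

theorem one_le_of_submodularApprox_tspCost {X : Type*} [MetricSpace X] [Finite X] [Nontrivial X]
    {r : X} {lam : ℝ} (hlam : SubmodularApprox (fun S : Set X => tspCost r S) lam) : 1 ≤ lam := by
  classical
  obtain ⟨g, -, hfg⟩ := hlam
  obtain ⟨x, hx⟩ := exists_ne r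
  have h1 := card_mul_le_tspCost (r := r) (S := {x}) (δ := dist r x) {x} (by simpa using hx.symm)
    (by simp) (by
      intro u hu v hv huv
      simp only [Finset.mem_insert, Finset.mem_singleton] at hu hv
      rcases hu with rfl | rfl <;> rcases hv with rfl | rfl
      · exact absurd rfl huv
      · exact le_rfl
      · exact (dist_comm _ _).le
      · exact absurd rfl huv)
  have h2 : 0 < dist r x := dist_pos.mpr hx.symm
  have h3 := (hfg {x}).1.trans (hfg {x}).2
  simp only [Finset.card_singleton, Nat.cast_one, one_mul] at h1
  exact le_of_mul_le_mul_right (by linarith) (h2.trans_le h1)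

/-! ### Spaces with exactly `n` points, and the constants -/

theorem le_tspSubmodularityGap {n : ℕ} {b : ℝ} (X : Type u) [MetricSpace X] [Fintype X]
    (hX : Fintype.card X = n) (r : X)
    (h : ∀ lam : ℝ, SubmodularApprox (fun S : Set X => tspCost r S) lam → b ≤ lam) :
    ENNReal.ofReal b ≤ tspSubmodularityGap.{u} n := by
  refine le_iSup_of_le X (le_iSup_of_le ‹_› (le_iSup_of_le ‹_› (le_iSup_of_le hX
    (le_iSup_of_le r (le_iInf₂ fun lam hlam => ?_)))))
  rw [← ENNReal.ofReal_coe_nnreal]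
  exact ENNReal.ofReal_le_ofReal (h lam hlam)

theorem one_le_tspSubmodularityGap {n : ℕ} (hn : 2 ≤ n) : 1 ≤ tspSubmodularityGap.{u} n := by
  obtain ⟨t, -, ht⟩ := Infinite.exists_superset_card_eq (∅ : Finset ℝ) n (by simp)
  have hcard : Fintype.card (ULift.{u} t) = n := by
    rw [Fintype.card_ulift, Fintype.card_coe, ht]
  have : Nontrivial (ULift.{u} t) := Fintype.one_lt_card_iff_nontrivial.mp (by omega)
  rw [← ENNReal.ofReal_one]
  exact le_tspSubmodularityGap (ULift.{u} t) hcard (Classical.arbitrary _)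
    fun lam => one_le_of_submodularApprox_tspCost

theorem le_tspSubmodularityGap_of_pow_le {n k : ℕ} (hk : 1 ≤ k) (hn : 2 * 4 ^ k ≤ n) :
    ENNReal.ofReal ((k + 1) / 8) ≤ tspSubmodularityGap.{u} n := by
  have : Nontrivial (ℝ × (Fin k → ℝ)) := inferInstance
  have : Infinite (ℝ × (Fin k → ℝ)) := inferInstance
  obtain ⟨t, hVt, ht⟩ := Infinite.exists_superset_card_eq (sawtoothVertices k) n
    ((card_sawtoothVertices_le k).trans hn)
  have hcard : Fintype.card (ULift.{u} t) = n := by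
    rw [Fintype.card_ulift, Fintype.card_coe, ht]
  have h0 : (0 : ℝ × (Fin k → ℝ)) ∈ t := by
    classical
    refine hVt (Finset.mem_image.mpr ⟨(0, 0), by simp, ?_⟩)
    simpa using sawtoothPath_zero k 0
  exact le_tspSubmodularityGap (ULift.{u} t) hcard ⟨⟨0, h0⟩⟩ fun lam =>
    le_of_submodularApprox_tspCost hk (fun x => (x.down : ℝ × (Fin k → ℝ)))
      (fun _ _ => rfl) (fun v hv => ⟨⟨⟨v, hVt hv⟩⟩, rfl⟩) rfl

theorem mul_log_le_tspSubmodularityGap {n : ℕ} (hn : 2 ≤ n) :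
    ENNReal.ofReal (1 / 24 * Real.log n) ≤ tspSubmodularityGap.{u} n := by
  set k := Nat.log 4 (n / 2) with hk
  have h1 : 4 ^ k ≤ n / 2 := Nat.pow_log_le_self 4 (by omega)
  have h2 : n / 2 < 4 ^ (k + 1) := Nat.lt_pow_succ_log_self (by norm_num) _
  have h3 : n ≤ 2 ^ (2 * k + 3) := by
    have : (2 : ℕ) ^ (2 * k + 3) = 2 * 4 ^ (k + 1) := by
      rw [show 4 = 2 ^ 2 from rfl, ← pow_mul, ← pow_succ']
      congr 1
    omega
  have h4 : Real.log n ≤ 2 * k + 3 := by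
    have hn0 : (0 : ℝ) < n := by exact_mod_cast (by omega : 0 < n)
    have h5 : Real.log n ≤ Real.log (2 ^ (2 * k + 3)) :=
      Real.log_le_log hn0 (by exact_mod_cast h3)
    rw [Real.log_pow] at h5
    push_cast at h5
    have h6 : (2 * k + 3 : ℝ) * Real.log 2 ≤ (2 * k + 3) * 1 :=
      mul_le_mul_of_nonneg_left (by linarith [Real.log_two_lt_d9]) (by positivity)
    linarith
  have hk0 : (0 : ℝ) ≤ k := Nat.cast_nonneg k
  -- For `k = 0`, `Real.log n ≤ 3` and the trivial bound 1 suffices. Otherwise `(2 * k + 3) / 24 ≤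
  -- (k + 1) / 8`, which is where 1/24 comes from.
  rcases Nat.eq_zero_or_pos k with h | h
  · refine le_trans ?_ (one_le_tspSubmodularityGap hn)
    rw [← ENNReal.ofReal_one]
    refine ENNReal.ofReal_le_ofReal ?_
    have : (k : ℝ) = 0 := by exact_mod_cast h
    linarith
  · refine le_trans (ENNReal.ofReal_le_ofReal ?_) (le_tspSubmodularityGap_of_pow_le h (by omega))
    linarith

theorem mainTheorem2 :
    ∃ c C : ℝ, 0 < c ∧ 0 < C ∧ ∀ n : ℕ, 2 ≤ n →
      ENNReal.ofReal (c * Real.log n) ≤ tspSubmodularityGap.{u} n ∧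
        tspSubmodularityGap.{u} n ≤ ENNReal.ofReal (C * Real.log n) := by
  refine ⟨1 / 24, 60, by norm_num, by norm_num, fun n hn =>
    ⟨mul_log_le_tspSubmodularityGap hn, ?_⟩⟩
  refine iSup_le fun X => iSup_le fun _ => iSup_le fun _ => iSup_le fun hX => iSup_le fun r => ?_
  subst hX
  exact submodularityGap_tspCost_le r hn
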